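/- **Conventions.** Let $N$ be a smooth manifold (finite-dimensional, Hausdorff, $\sigma$-compact), let $E$ be the category of open subsets of $N$ with its usual topology, and let $H^k(N,L)$ be the Čech cohomology of $N$ with values in a sheaf of abelian groups $L$. Let $\mathbb{C}_N$ and $\mathbb{C}^*_N$ be the sheaves of smooth functions with values in $\mathbb{C}$ and in $\mathbb{C}^*=\mathbb{C}\setminus\{0\}$, and let $H^k(N,\mathbb{Z})$ be the cohomology of the sheaf of locally constant integer functions. All sheaves below are sheaves of abelian groups on $N$. **Gerbed towers.** A (commutative) $n$-gerbed tower on $N$, $n\ge 1$, is a sequence of categories and functors $F_n\xrightarrow{p_n}F_{n-1}\to\cdots\to F_1\xrightarrow{p_1}F_0=E$ with sheaves $L_1,\dots,L_n$ and $L'_2,\dots,L'_n$ such that 1. for $0\le l<n$, $p_{l+1}$ is a gerbe (a stack in groupoids, locally non-empty and locally connected) over $F_l$ with the topology inherited from $E$; it is bounded by $L_{l+1}$: for every object $x$ of $F_{l+1}$ over the open set $U\in E$, the group of automorphisms of $x$ over the identity of $p_{l+1}(x)$ is identified with $L_{l+1}(U)$, compatibly with all arrows of $F_{l+1}$; 2.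 for $0\le l\le n$, $F_l$ has strict restriction functors: for $x\in F_l$ over $U$ and $V\subseteq U$ an arrow $x|_V\to x$ over $V\subseteq U$, such that restricting to $V$ and then to $W\subseteq V$ is restricting to $W$; 3. for $1\le l<n$, there are sheaf morphisms $\iota_{l+1}:L_{l+1}\to L'_{l+1}$ and $\pi_{l+1}:L'_{l+1}\to L_l$, and for every object $x$ of $F_{l+1}$ over $U$ the group of automorphisms of $x$ whose image in $F_{l-1}$ is the identity is identified with $L'_{l+1}(U)$, compatibly with restrictions; under the identifications, $\iota_{l+1}$ is the inclusion of the automorphisms over the identity of $p_{l+1}(x)$, and $\pi_{l+1}$ is the action of $p_{l+1}$ on automorphisms. **The classifying cocycle.** Choose an open cover $(U_i)$ of $N$, objects $x_i$ of $F_1$ over $U_i$, and isomorphisms $u_{ij}:x_j|_{U_{ij}}\to x_i|_{U_{ij}}$ with $u_{ji}=u_{ij}^{-1}$; let $c_{ijk}=u_{ki}u_{ij}u_{jk}\in L_1(U_{ijk})$. This gives a class $[c_2]\in H^2(N,L_1)$. Inductively, represent $[c_{l+1}]\in H^{l+1}(N,L_l)$ by a cocycle $z$ on an open cover, choose objects $y_s$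 of $F_{l+1}$ over the $(l+2)$-fold intersections $U_s$ and automorphisms $b_s\in L'_{l+1}(U_s)$ of $y_s$ over the automorphisms $z_s$ of $p_{l+1}(y_s)$; the Čech boundary of $(b_s)$ has values in $L_{l+1}$ and gives a class $[c_{l+2}]\in H^{l+2}(N,L_{l+1})$. The class of the classifying cocycle of the tower is $[c_{n+1}]\in H^{n+1}(N,L_n)$. **Geometric classes.** A class of $H^{n+2}(N,\mathbb{Z})$ is geometric if it is the image, under the connecting homomorphism $\delta:H^{n+1}(N,\mathbb{C}^*_N)\to H^{n+2}(N,\mathbb{Z})$ of the exponential sequence $0\to\mathbb{Z}\to\mathbb{C}_N\xrightarrow{f\mapsto e^{2\pi i f}}\mathbb{C}^*_N\to0$, of a class that is the class of the classifying cocycle of some $n$-gerbed tower on $N$ with $L_n\cong\mathbb{C}^*_N$. **Theorem 6.0.1.** Let $N$ be a smooth manifold and $n\ge1$. The connecting homomorphism $\delta:H^{n+1}(N,\mathbb{C}^*_N)\to H^{n+2}(N,\mathbb{Z})$ is an isomorphism and, for every geometric class $c\in H^{n+2}(N,\mathbb{Z})$, the corresponding class $\delta^{-1}(c)\in H^{n+1}(N,\mathbb{C}^*_N)$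 is the class of the classifying cocycle of an $n$-gerbed tower on $N$ with $L_n\cong\mathbb{C}^*_N$. -/

import Mathlib

open CategoryTheory TopologicalSpace Opposite
open scoped ContDiff Manifold

universe u

namespace GerbedTowers

/-! ### Sheaves of abelian groups and Čech cohomology -/

section Cech

variable {N : Type u} [TopologicalSpace N]

variable (N) in
/-- Sheaves of abelian groups on the topological space `N`. -/
abbrev AbSheaf := TopCat.Sheaf AddCommGrpCat.{u} (TopCat.of N)

/-- The group of sections `L(U)`. -/
abbrev AbSheaf.sec (L : AbSheaf N) (U : Opens N) : Type u := L.presheaf.obj (op U)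

/-- The restriction `L(U) → L(V)` for `V ⊆ U`. -/
def AbSheaf.res (L : AbSheaf N) {V U : Opens N} (h : V ≤ U) : L.sec U →+ L.sec V :=
  (L.presheaf.map (homOfLE h).op).hom

/-- A morphism of sheaves on sections. -/
def AbSheaf.app {L M : AbSheaf N} (φ : L ⟶ M) (U : Opens N) : L.sec U →+ M.sec U :=
  (φ.hom.app (op U)).hom

theorem AbSheaf.res_res (L : AbSheaf N) {W V U : Opens N} (h : W ≤ V) (h' : V ≤ U) (s : L.sec U) :
    L.res h (L.res h' s) = L.res (h.trans h') s := by
  have := congrArg (fun f => f.hom s) (L.presheaf.map_comp (homOfLE h').op (homOfLE h).op)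
  exact this.symm

theorem AbSheaf.res_app {L M : AbSheaf N} (φ : L ⟶ M) {V U : Opens N} (h : V ≤ U) (s : L.sec U) :
    M.res h (AbSheaf.app φ U s) = AbSheaf.app φ V (L.res h s) := by
  have := congrArg (fun f => f.hom s) (φ.hom.naturality (homOfLE h).op)
  exact this.symm

variable (N) in
/-- An open cover of `N` indexed by the points of `N`, with `x ∈ U x`. These covers are cofinal
among all open covers of `N`, and one refines another along the identity of the index set as soon
as it is pointwise smaller. -/
abbrev PtCover := {U : N → Opens N // ∀ x, x ∈ U x}

/-- The intersection `U_{s 0} ∩ … ∩ U_{s k}`. -/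
def PtCover.inter (U : PtCover N) {k : ℕ} (s : Fin (k + 1) → N) : Opens N := ⨅ a, U.1 (s a)

theorem PtCover.inter_le (U : PtCover N) {k : ℕ} (s : Fin (k + 1) → N) (a : Fin (k + 1)) :
    U.inter s ≤ U.1 (s a) := iInf_le _ a

theorem PtCover.inter_face (U : PtCover N) {k : ℕ} (s : Fin (k + 2) → N) (a : Fin (k + 2)) :
    U.inter s ≤ U.inter (s ∘ a.succAbove) := le_iInf fun b => iInf_le _ (a.succAbove b)

theorem PtCover.inter_mono {U V : PtCover N} (h : V ≤ U) {k : ℕ} (s : Fin (k + 1) → N) :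
    V.inter s ≤ U.inter s := iInf_mono fun a => h (s a)

/-- Čech `k`-cochains of the cover `U` with values in `L`. -/
abbrev Cochain (U : PtCover N) (L : AbSheaf N) (k : ℕ) : Type u :=
  ∀ s : Fin (k + 1) → N, L.sec (U.inter s)

/-- The Čech differential `(d c)_s = ∑_a (-1)^a c_{s_0 … ŝ_a … s_{k+1}}`. -/
def Cochain.d (U : PtCover N) (L : AbSheaf N) (k : ℕ) : Cochain U L k →+ Cochain U L (k + 1) where
  toFun c := fun s => ∑ a : Fin (k + 2), (-1 : ℤ) ^ (a : ℕ) •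
    L.res (U.inter_face s a) (c (s ∘ a.succAbove))
  map_zero' := by funext s; simp
  map_add' c c' := by funext s; simp [Finset.sum_add_distrib]

/-- Čech cocycles. -/
abbrev Cocycle (U : PtCover N) (L : AbSheaf N) (k : ℕ) : AddSubgroup (Cochain U L k) :=
  (Cochain.d U L k).ker

/-- Čech coboundaries. -/
def coboundaries (U : PtCover N) (L : AbSheaf N) : ∀ k : ℕ, AddSubgroup (Cochain U L k)
  | 0 => ⊥
  | k + 1 => (Cochain.d U L k).range

/-- The Čech cohomology group of the cover `U`. -/
abbrev CoverH (U : PtCover N) (L : AbSheaf N) (k : ℕ) : Type u :=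
  Cocycle U L k ⧸ (coboundaries U L k).addSubgroupOf (Cocycle U L k)

/-- The map on cochains induced by a refinement `V ≤ U` and a morphism of sheaves. -/
def Cochain.map {U V : PtCover N} (h : V ≤ U) {L M : AbSheaf N} (φ : L ⟶ M) (k : ℕ) :
    Cochain U L k →+ Cochain V M k where
  toFun c := fun s => AbSheaf.app φ _ (L.res (PtCover.inter_mono h s) (c s))
  map_zero' := by funext s; simp
  map_add' c c' := by funext s; simp

theorem Cochain.d_map {U V : PtCover N} (h : V ≤ U) {L M : AbSheaf N} (φ : L ⟶ M) (k : ℕ)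
    (c : Cochain U L k) :
    Cochain.d V M k (Cochain.map h φ k c) = Cochain.map h φ (k + 1) (Cochain.d U L k c) := by
  funext s
  simp only [Cochain.d, Cochain.map, AddMonoidHom.coe_mk, ZeroHom.coe_mk, map_sum, map_zsmul,
    AbSheaf.res_app, AbSheaf.res_res]

/-- The induced map on cocycles. -/
def Cocycle.map {U V : PtCover N} (h : V ≤ U) {L M : AbSheaf N} (φ : L ⟶ M) (k : ℕ) :
    Cocycle U L k →+ Cocycle V M k :=
  ((Cochain.map h φ k).comp (Cocycle U L k).subtype).codRestrict _ fun c => by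
    have hc : Cochain.d U L k c.1 = 0 := c.2
    change Cochain.d V M k (Cochain.map h φ k c.1) = 0
    rw [Cochain.d_map, hc, map_zero]

/-- The induced map on the cohomology of covers. -/
def CoverH.map {U V : PtCover N} (h : V ≤ U) {L M : AbSheaf N} (φ : L ⟶ M) (k : ℕ) :
    CoverH U L k →+ CoverH V M k :=
  QuotientAddGroup.map _ _ (Cocycle.map h φ k) (by
    intro c hc
    cases k with
    | zero =>
      have h0 : c.1 = 0 := hc
      change Cochain.map h φ 0 c.1 = 0
      rw [h0, map_zero]
    | succ k =>
      obtain ⟨b, hb⟩ := (show c.1 ∈ (Cochain.d U L k).range from hc)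
      exact ⟨Cochain.map h φ k b, by rw [Cochain.d_map, hb]; rfl⟩)

open Classical in
/-- Čech cohomology `H^k(N, L)`: the colimit of the cohomology of covers over all refinements. -/
abbrev CechH (L : AbSheaf N) (k : ℕ) : Type u :=
  AddCommGroup.DirectLimit (fun U : (PtCover N)ᵒᵈ => CoverH (OrderDual.ofDual U) L k)
    (fun _ _ h => CoverH.map (OrderDual.ofDual_le_ofDual.mpr h) (𝟙 L) k)

open Classical in
/-- The class in `H^k(N, L)` of a cocycle of a cover. -/
noncomputable def CechH.cls (U : PtCover N) (L : AbSheaf N) (k : ℕ) : Cocycle U L k →+ CechH L k :=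
  (AddCommGroup.DirectLimit.of (fun U : (PtCover N)ᵒᵈ => CoverH (OrderDual.ofDual U) L k)
    (fun _ _ h => CoverH.map (OrderDual.ofDual_le_ofDual.mpr h) (𝟙 L) k)
    (OrderDual.toDual U)).comp
      (QuotientAddGroup.mk' ((coboundaries U L k).addSubgroupOf (Cocycle U L k)))

open Classical in
/-- The map on Čech cohomology induced by a morphism of sheaves. -/
noncomputable def CechH.map {L M : AbSheaf N} (φ : L ⟶ M) (k : ℕ) : CechH L k →+ CechH M k :=
  AddCommGroup.DirectLimit.map (fun _ => CoverH.map le_rfl φ k) (by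
    intro U V h
    ext c
    apply congrArg (QuotientAddGroup.mk)
    apply Subtype.ext
    funext s
    change AbSheaf.app φ _ (L.res _ (AbSheaf.app (𝟙 L) _ (L.res _ (c.1 s)))) =
      AbSheaf.app (𝟙 M) _ (M.res _ (AbSheaf.app φ _ (L.res _ (c.1 s))))
    simp only [AbSheaf.res_app, AbSheaf.res_res]
    rfl)

/-- `d` is an image of `c` under the connecting homomorphism `H^k(N, C) → H^{k+1}(N, A)` of
`0 → A → B → C → 0`: on some cover, `c` is the class of a cocycle `z` that lifts to a `B`-valued
cochain `b`, and `d` is the class of a cocycle `w` with `f(w) = ∂ b`. -/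
def IsConnecting {A B C : AbSheaf N} (f : A ⟶ B) (g : B ⟶ C) {k : ℕ} (c : CechH C k)
    (d : CechH A (k + 1)) : Prop :=
  ∃ (U : PtCover N) (z : Cocycle U C k) (b : Cochain U B k) (w : Cocycle U A (k + 1)),
    CechH.cls U C k z = c ∧ CechH.cls U A (k + 1) w = d ∧
    (∀ s, AbSheaf.app g _ (b s) = z.1 s) ∧
    ∀ s, AbSheaf.app f _ (w.1 s) = Cochain.d U B k b s

end Cech

/-! ### Gerbes -/

section Gerbes

variable {N : Type u} [TopologicalSpace N]

/-- Let `q : B ⥤ Opens N`. A sieve on `X` is covering if the opens `q(Y)`, for `Y → X` in the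
sieve, cover `q(X)`. For `B = Opens N` and `q = 𝟭` this is the usual topology of `N`; for `B`
fibered in groupoids over `Opens N` it is the topology on `B` inherited from `N`. -/
def Covers {B : Type u} [Category.{u} B] (q : B ⥤ Opens N) {X : B} (R : Sieve X) : Prop :=
  ∀ x ∈ q.obj X, ∃ (Y : B) (f : Y ⟶ X), R f ∧ x ∈ q.obj Y

section

variable {B : Type u} [Category.{u} B]

/-- The category `B_X` of arrows to `X`, over `B`. -/
abbrev sliceOver (X : B) : BasedCategory.{u, u} B := BasedCategory.ofFunctor (Over.forget X)

/-- A sieve on `X`, as a full subcategory of `B_X`, over `B`. -/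
abbrev sieveOver {X : B} (R : Sieve X) : BasedCategory.{u, u} B :=
  BasedCategory.ofFunctor R.arrows.diagram

/-- The inclusion of a sieve on `X` into `B_X`. -/
def sieveInclusion {X : B} (R : Sieve X) : BasedFunctor (sieveOver R) (sliceOver X) where
  toFunctor := ObjectProperty.ι (fun f : Over X => R.arrows f.hom)
  w := rfl

/-- The restriction `Hom_B(B_X, F) → Hom_B(R, F)` of functors over `B`. -/
def restrictToSieve (F : BasedCategory.{u, u} B) {X : B} (R : Sieve X) :
    BasedFunctor (sliceOver X) F ⥤ BasedFunctor (sieveOver R) F where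
  obj G := (sieveInclusion R).comp G
  map α := BasedCategory.whiskerLeft (sieveInclusion R) α

end

/-- `p : F ⥤ B` is a gerbe on the site `B` whose topology comes from `q : B ⥤ Opens N`.
All arrows of `F` being cartesian, every functor over `B` to `F` is a cartesian functor. -/
structure IsGerbe {B : Type u} [Category.{u} B] (q : B ⥤ Opens N) {F : Type u} [Category.{u} F]
    (p : F ⥤ B) : Prop where
  /-- `F` is a fibered category over `B` … -/
  fibered : p.IsFibered
  /-- … fibered in groupoids, … -/
  groupoids : ∀ {x y : F} (φ : x ⟶ y), p.IsStronglyCartesian (p.map φ) φ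
  /-- … which is a sheaf of categories; … -/
  stack : ∀ (X : B) (R : Sieve X), Covers q R →
    (restrictToSieve (BasedCategory.ofFunctor p) R).IsEquivalence
  /-- … it locally has objects, … -/
  locally_nonempty : ∀ X : B, ∃ R : Sieve X, Covers q R ∧
    ∀ (Y : B) (f : Y ⟶ X), R f → ∃ y : F, p.obj y = Y
  /-- … and any two objects of a fiber are locally isomorphic. -/
  locally_connected : ∀ (X : B) (x y : F), p.obj x = X → p.obj y = X →
    ∃ R : Sieve X, Covers q R ∧ ∀ (Y : B) (f : Y ⟶ X), R f →
      ∃ (z : F) (φ : z ⟶ x) (ψ : z ⟶ y), p.IsHomLift f φ ∧ p.IsHomLift f ψ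

/-- An identification, for each object `x` of `F`, of `L(q(x))` with the group of those
automorphisms of `x` that become the identity under `p`, compatible with the arrows in `W`. -/
structure AutIdent (L : AbSheaf N) {F : Type u} [Category.{u} F] (q : F ⥤ Opens N)
    {B : Type u} [Category.{u} B] (p : F ⥤ B) (W : MorphismProperty F) where
  act : ∀ x : F, Multiplicative (L.sec (q.obj x)) →* Aut x
  injective : ∀ x, Function.Injective (act x)
  mem_range : ∀ (x : F) (a : Aut x), a ∈ (act x).range ↔ p.map a.hom = 𝟙 (p.obj x)
  natural : ∀ {x y : F} (φ : x ⟶ y), W φ → ∀ s : L.sec (q.obj y),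
    (act x (.ofAdd (L.res (leOfHom (q.map φ)) s))).hom ≫ φ = φ ≫ (act y (.ofAdd s)).hom

/-- Strict restriction functors: for `x` over `U` and `V ⊆ U` an arrow `x|_V → x` over `V ⊆ U`, such
that restricting to `V` and then to `W` is restricting to `W`. -/
structure Restrictions (F : BasedCategory.{u, u} (Opens N)) where
  res : ∀ (x : F.obj) (V : Opens N), V ≤ F.p.obj x → Over x
  res_obj : ∀ (x : F.obj) (V : Opens N) (h : V ≤ F.p.obj x), F.p.obj (res x V h).left = V
  res_res : ∀ (x : F.obj) (V W : Opens N) (h : V ≤ F.p.obj x) (h' : W ≤ V),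
    Over.mk ((res (res x V h).left W (h'.trans_eq (res_obj x V h).symm)).hom ≫ (res x V h).hom) =
      res x W (h'.trans h)

/-- The restriction arrows `x|_V → x`. -/
inductive Restrictions.arrows {F : BasedCategory.{u, u} (Opens N)} (r : Restrictions F) :
    MorphismProperty F.obj
  | mk (x : F.obj) (V : Opens N) (h : V ≤ F.p.obj x) : r.arrows (r.res x V h).hom

end Gerbes

/-! ### Gerbed towers -/

section Towers

variable (N : Type u) [TopologicalSpace N]

/-- A commutative `n`-gerbed tower `F_n → F_{n-1} → ⋯ → F_1 → F_0 = E`, where `E` is the category of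
open subsets of `N`. Only `F_0, …, F_n`, `L_1, …, L_n` and `L'_2, …, L'_n` play a role. The
"2-arrows" of `F_l` between two objects are the arrows of the category `F_l`, and the "1-arrows"
of `F_{l+1}` that they cover are the arrows of `F_l` between the images of these objects. The topos
of an object `X` of `F_l` is the slice of `F_l` over `X`, which is equivalent to the site of open
subsets of the image of `X` in `E`; an arrow of `F_l` acts on these slices. -/
structure GerbedTower (n : ℕ) where
  pos : 0 < n
  F : ℕ → BasedCategory.{u, u} (Opens N)
  F_zero : F 0 = BasedCategory.ofFunctor (Functor.id (Opens N))
  /-- the projections `p_{l+1} : F_{l+1} → F_l` -/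
  proj : ∀ l, l < n → BasedFunctor (F (l + 1)) (F l)
  L : ℕ → AbSheaf N
  /-- `F_{l+1}` is a gerbe over `F_l`; in particular arrows of `F_l` lift to `F_{l+1}` -/
  gerbe : ∀ l (h : l < n), IsGerbe (F l).p (proj l h).toFunctor
  /-- … bounded by the sheaf `L_{l+1}` -/
  band : ∀ l (h : l < n), AutIdent (L (l + 1)) (F (l + 1)).p (proj l h).toFunctor ⊤
  restr : ∀ l, l ≤ n → Restrictions (F l)
  L' : ℕ → AbSheaf N
  /-- the automorphisms of `x` in `F_{l+2}` whose image in `F_{l+1}` belongs to `L_{l+1}`, that is,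
  whose image in `F_l` is the identity, form the sheaf `L'_{l+2}` -/
  ext : ∀ l (h : l + 1 < n), AutIdent (L' (l + 2)) (F (l + 2)).p
    ((proj (l + 1) h).toFunctor ⋙ (proj l (by omega)).toFunctor) (restr (l + 2) h).arrows
  /-- the inclusion `L_{l+2} → L'_{l+2}` -/
  ι : ∀ l, l + 1 < n → (L (l + 2) ⟶ L' (l + 2))
  ι_act : ∀ l (h : l + 1 < n) (x : (F (l + 2)).obj) (s : (L (l + 2)).sec ((F (l + 2)).p.obj x)),
    (ext l h).act x (.ofAdd (AbSheaf.app (ι l h) _ s)) = (band (l + 1) h).act x (.ofAdd s)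
  /-- the projection `L'_{l+2} → L_{l+1}` -/
  π : ∀ l, l + 1 < n → (L' (l + 2) ⟶ L (l + 1))
  π_act : ∀ l (h : l + 1 < n) (x : (F (l + 2)).obj) (s : (L' (l + 2)).sec ((F (l + 2)).p.obj x)),
    (proj (l + 1) h).map ((ext l h).act x (.ofAdd s)).hom =
      ((band l (by omega)).act ((proj (l + 1) h).obj x)
        (.ofAdd ((L (l + 1)).res ((proj (l + 1) h).w_obj x).le (AbSheaf.app (π l h) _ s)))).hom

variable {N}

/-- `c` is the class of the classifying cocycle of the gerbe `F_1 → E`. Here `x_i` is an object over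
`U_i`, and `u_{ij} : x_j|_{U_i ∩ U_j} → x_i|_{U_i ∩ U_j}`, with `u_{ji}` inverse to `u_{ij}`, is
given by its action `(w : W → x_j) ↦ (u_{ij} ∘ w : W → x_i)` on arrows from objects `W` over open
subsets of `U_i ∩ U_j`; the cocycle is `c_{ijk} = u_{ki} ∘ u_{ij} ∘ u_{jk}`, an automorphism of the
restriction of `x_k` to `U_i ∩ U_j ∩ U_k`. -/
def GerbedTower.IsGerbeClass {n : ℕ} (T : GerbedTower N n) (c : CechH (T.L 1) 2) : Prop :=
  ∃ (U : PtCover N) (z : Cocycle U (T.L 1) 2) (x : N → (T.F 1).obj)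
    (_ : ∀ i, (T.F 1).p.obj (x i) = U.1 i)
    (v : ∀ (i j : N) (W : (T.F 1).obj), (T.F 1).p.obj W ≤ U.1 i → (W ⟶ x j) → (W ⟶ x i)),
    (∀ (i j : N) (W W' : (T.F 1).obj) (h : (T.F 1).p.obj W ≤ U.1 i) (ψ : W' ⟶ W) (w : W ⟶ x j),
      v i j W' ((leOfHom ((T.F 1).p.map ψ)).trans h) (ψ ≫ w) = ψ ≫ v i j W h w) ∧
    (∀ (i j : N) (W : (T.F 1).obj) (hi : (T.F 1).p.obj W ≤ U.1 i) (hj : (T.F 1).p.obj W ≤ U.1 j)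
      (w : W ⟶ x i), v i j W hi (v j i W hj w) = w) ∧
    (∀ (s : Fin 3 → N) (W : (T.F 1).obj) (h : (T.F 1).p.obj W ≤ U.inter s) (w : W ⟶ x (s 2)),
      v (s 2) (s 0) W (h.trans (U.inter_le s 2))
        (v (s 0) (s 1) W (h.trans (U.inter_le s 0))
          (v (s 1) (s 2) W (h.trans (U.inter_le s 1)) w)) =
      ((T.band 0 T.pos).act W (.ofAdd ((T.L 1).res h (z.1 s)))).hom ≫ w) ∧
    CechH.cls U (T.L 1) 2 z = c

/-- `d` is the class of the cocycle built from a cocycle `z` of class `c` by choosing objects `y_s`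
of `F_{l+2}` over the intersections `U_s`, automorphisms of the `y_s` over the automorphisms
`z_s` of their images in `F_{l+1}`, and taking the Čech boundary. -/
def GerbedTower.IsNextClass {n : ℕ} (T : GerbedTower N n) (l : ℕ) (h : l + 1 < n)
    (c : CechH (T.L (l + 1)) (l + 2)) (d : CechH (T.L (l + 2)) (l + 3)) : Prop :=
  ∃ (U : PtCover N) (z : Cocycle U (T.L (l + 1)) (l + 2)) (b : Cochain U (T.L' (l + 2)) (l + 2))
    (w : Cocycle U (T.L (l + 2)) (l + 3)),
    CechH.cls U _ _ z = c ∧ CechH.cls U _ _ w = d ∧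
    (∀ s, ∃ (y : (T.F (l + 2)).obj) (hy : (T.F (l + 2)).p.obj y = U.inter s),
      (T.proj (l + 1) h).map
          ((T.ext l h).act y (.ofAdd ((T.L' (l + 2)).res hy.le (b s)))).hom =
        ((T.band l (by omega)).act ((T.proj (l + 1) h).obj y)
          (.ofAdd ((T.L (l + 1)).res
            (((T.proj (l + 1) h).w_obj y).trans hy).le (z.1 s)))).hom) ∧
    ∀ s, AbSheaf.app (T.ι l h) _ (w.1 s) = Cochain.d U (T.L' (l + 2)) (l + 2) b s

/-- `c ∈ H^{n+1}(N, L_n)` is the class of the classifying cocycle of the tower: it is the last of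
classes `c_2 ∈ H²(N, L_1), …, c_{n+1} ∈ H^{n+1}(N, L_n)` attached successively to the tower. -/
def GerbedTower.IsClassifyingClass {n : ℕ} (T : GerbedTower N n) (c : CechH (T.L n) (n + 1)) :
    Prop :=
  ∃ cs : ∀ l, CechH (T.L l) (l + 1), T.IsGerbeClass (cs 1) ∧
    (∀ l (h : l + 1 < n), T.IsNextClass l h (cs (l + 1)) (cs (l + 2))) ∧ cs n = c

/-- `c ∈ H^{n+1}(N, A)` is the class of the classifying cocycle of an `n`-gerbed tower on `N` whose
last sheaf `L_n` is `A`. -/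
def IsTowerClass (A : AbSheaf N) (n : ℕ) (c : CechH A (n + 1)) : Prop :=
  ∃ (T : GerbedTower N n) (e : T.L n ≅ A) (t : CechH (T.L n) (n + 1)),
    T.IsClassifyingClass t ∧ CechH.map e.hom (n + 1) t = c

end Towers

/-! ### The exponential sequence -/

section Exponential

/-- The sheaf of functions to `G` which satisfy a local predicate that is stable under the group
operations. -/
def funSheaf {N : Type u} [TopologicalSpace N] {G : Type} [AddCommGroup G]
    (P : TopCat.LocalPredicate (fun _ : TopCat.of N => G))
    (hz : ∀ U : Opens N, P.pred (fun _ : U => (0 : G)))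
    (ha : ∀ (U : Opens N) (f g : U → G), P.pred f → P.pred g → P.pred (fun x => f x + g x))
    (hn : ∀ (U : Opens N) (f : U → G), P.pred f → P.pred (fun x => -f x)) : AbSheaf N where
  obj :=
    { obj := fun U => AddCommGrpCat.of
        ({ carrier := {f | P.pred f}
           zero_mem' := hz U.unop
           add_mem' := fun {f g} hf hg => ha U.unop f g hf hg
           neg_mem' := fun {f} hf => hn U.unop f hf } : AddSubgroup (U.unop → G))
      map := fun i => AddCommGrpCat.ofHom
        { toFun := fun f => ⟨fun x => f.1 ⟨x.1, leOfHom i.unop x.2⟩, P.res i.unop f.1 f.2⟩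
          map_zero' := rfl
          map_add' := fun _ _ => rfl } }
  property := by
    rw [CategoryTheory.Presheaf.isSheaf_iff_isSheaf_forget _ _
      (CategoryTheory.forget AddCommGrpCat)]
    exact (TopCat.subsheafToTypes P).property

/-- The sheaf `ℤ_N` of locally constant integer functions. -/
def intSheaf (N : Type u) [TopologicalSpace N] : AbSheaf N :=
  funSheaf (TopCat.continuousLocal (TopCat.of N) ℤ) (fun _ => continuous_const)
    (fun _ _ _ hf hg => Continuous.add hf hg) (fun _ _ hf => Continuous.neg hf)

variable {E : Type*} [NormedAddCommGroup E] [NormedSpace ℝ E] {H : Type*} [TopologicalSpace H]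
  (I : ModelWithCorners ℝ E H) (N : Type u) [TopologicalSpace N] [ChartedSpace H N]

/-- Smoothness of complex functions on open subsets of `N`. -/
def smoothPred : TopCat.LocalPredicate (fun _ : TopCat.of N => ℂ) where
  pred {U} f := ContMDiff I 𝓘(ℝ, ℂ) ∞ (fun x : (U : Opens N) => f x)
  res {_ _} i f hf := hf.comp (contMDiff_inclusion (leOfHom i))
  locality {U} f h x := by
    obtain ⟨V, hxV, i, hV⟩ := h x
    have hVU : V ≤ U := leOfHom i
    exact ((contDiffWithinAt_localInvariantProp (I := I) (I' := 𝓘(ℝ, ℂ)) ∞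
      ).liftPropAt_iff_comp_inclusion hVU f ⟨x.1, hxV⟩).2 (hV ⟨x.1, hxV⟩)

/-- The sheaf `ℂ_N` of smooth complex functions. -/
def smoothSheafC : AbSheaf N :=
  funSheaf (smoothPred I N) (fun _ => contMDiff_const)
    (fun _ _ _ hf hg => ContMDiff.add hf hg) (fun _ _ hf => ContMDiff.neg hf)

/-- Smoothness of functions to `ℂ^*` (written additively) on open subsets of `N`. -/
def smoothUnitsPred : TopCat.LocalPredicate (fun _ : TopCat.of N => Additive ℂˣ) where
  pred f := (smoothPred I N).pred (fun x => ((f x).toMul : ℂ))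
  res i _ hf := (smoothPred I N).res i _ hf
  locality _ hf := (smoothPred I N).locality _ hf

/-- The sheaf `ℂ^*_N` of smooth functions to `ℂ^*`. -/
def smoothSheafCStar : AbSheaf N :=
  funSheaf (smoothUnitsPred I N) (fun _ => contMDiff_const)
    (fun _ _ _ hf hg =>
      (contDiff_mul (𝕜 := ℝ) (n := ∞) (𝔸 := ℂ)).comp_contMDiff (ContMDiff.prodMk_space hf hg))
    (fun _ f hf => by
      intro x
      have hx := ContMDiffAt.comp x
        (contDiffAt_inv ℝ (n := ∞) ((f x).toMul).ne_zero).contMDiffAt (hf x)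
      exact hx.congr_of_eventuallyEq (.of_forall fun y => Units.val_inv_eq_inv_val _))

/-- The inclusion `ℤ_N → ℂ_N`. -/
def intToSmooth : intSheaf N ⟶ smoothSheafC I N :=
  ObjectProperty.homMk
    { app := fun U => AddCommGrpCat.ofHom
        { toFun := fun f => ⟨fun x => ((f.1 x : ℤ) : ℂ), by
            have hf : Continuous f.1 := f.2
            intro x
            have hx : ∀ᶠ y in nhds x, f.1 y = f.1 x :=
              hf.continuousAt.eventually (p := fun m => m = f.1 x) (by simp [nhds_discrete])
            refine (contMDiffAt_const (c := ((f.1 x : ℤ) : ℂ))).congr_of_eventuallyEq ?_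
            filter_upwards [hx] with y hy
            rw [hy]⟩
          map_zero' := by apply Subtype.ext; funext x; exact Int.cast_zero
          map_add' := fun f g => by apply Subtype.ext; funext x; exact Int.cast_add _ _ }
      naturality := fun _ _ _ => rfl }

/-- The exponential `ℂ_N → ℂ^*_N`, `f ↦ exp(2πi f)`. -/
noncomputable def smoothExp : smoothSheafC I N ⟶ smoothSheafCStar I N :=
  ObjectProperty.homMk
    { app := fun U => AddCommGrpCat.ofHom
        { toFun := fun f => ⟨fun x => Additive.ofMul (Units.mk0
            (Complex.exp (2 * Real.pi * Complex.I * f.1 x)) (Complex.exp_ne_zero _)), by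
            have hf : ContMDiff I 𝓘(ℝ, ℂ) ∞ f.1 := f.2
            have he : ContDiff ℝ ∞ (fun w : ℂ => Complex.exp (2 * Real.pi * Complex.I * w)) := by
              fun_prop
            exact he.contMDiff.comp hf⟩
          map_zero' := by
            apply Subtype.ext; funext x; apply Additive.toMul.injective; apply Units.ext
            change Complex.exp (2 * Real.pi * Complex.I * 0) = 1
            simp
          map_add' := fun f g => by
            apply Subtype.ext; funext x; apply Additive.toMul.injective; apply Units.ext
            change Complex.exp (2 * Real.pi * Complex.I * (f.1 x + g.1 x)) =
              Complex.exp (2 * Real.pi * Complex.I * f.1 x) *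
                Complex.exp (2 * Real.pi * Complex.I * g.1 x)
            rw [mul_add, Complex.exp_add] }
      naturality := fun _ _ _ => rfl }

variable {N} in
/-- A class of `H^{n+2}(N, ℤ)` is geometric if it is the image, under the connecting homomorphism
of the exponential sequence, of a class of `H^{n+1}(N, ℂ^*_N)` which is the classifying cocycle of
an `n`-gerbed tower. -/
def IsGeometric (n : ℕ) (c : CechH (intSheaf N) (n + 2)) : Prop :=
  ∃ x : CechH (smoothSheafCStar I N) (n + 1),
    IsTowerClass (smoothSheafCStar I N) n x ∧
      IsConnecting (intToSmooth I N) (smoothExp I N) x c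

end Exponential

end GerbedTowers

/-! The sheaf of smooth complex functions is fine, so its Čech cohomology vanishes in positive
degrees. In the long exact sequence of the exponential sequence the connecting map between degrees
`n + 1` and `n + 2` is therefore bijective. A geometric class is by definition the image of a tower
class `x`, and injectivity forces its preimage under `δ` to be `x` itself. The geometry of gerbes
plays no role beyond this definition.

The work lies in Čech theory. `IsConnecting` is only a relation, so `exists_connecting_addEquiv`
shows that it is additive, total on both sides and single-valued on both sides. The inputs are left
exactness on sections (`exponential_isLeftExact`), local logarithms (`smoothExp_locallyLifts`),
lifting of whole cochains after a refinement, by paracompactness (`LocallyLifts.cochainsLift`), and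
acyclicity by a partition of unity (`smoothSheafC_cechAcyclic`).

One complication is that the colimit defining `CechH` refines covers only along the identity of the
index set, whereas lifting a cochain needs a refinement along a map `τ` of indices. A prism homotopy
shows that both give the same class (`CechH.cls_pull`). -/

namespace GerbedTowers

/-! ### The prism homotopy on alternating cochains of a set -/

section Prism

variable {X X' Y Y' A A' : Type*} [AddCommGroup A] [AddCommGroup A']

/-- The simplicial differential on functions of tuples. -/
def tupleD {m : ℕ} (c : (Fin m → X) → A) (s : Fin (m + 1) → X) : A :=
  ∑ a : Fin (m + 1), (-1 : ℤ) ^ (a : ℕ) • c (s ∘ a.succAbove)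

/-- Every face but the first keeps `x` in front, with its sign shifted by one. This recursion
replaces manipulations of double alternating sums in what follows. -/
theorem tupleD_cons {m : ℕ} (c : (Fin (m + 1) → X) → A) (x : X) (r : Fin (m + 1) → X) :
    tupleD c (Fin.cons x r) = c r - tupleD (fun t => c (Fin.cons x t)) r := by
  have h0 : (Fin.cons x r : Fin (m + 2) → X) ∘ Fin.succAbove 0 = r := by
    funext i; simp
  have h1 (a : Fin (m + 1)) : (Fin.cons x r : Fin (m + 2) → X) ∘ a.succ.succAbove =
      Fin.cons x (r ∘ a.succAbove) := by
    funext i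
    refine Fin.cases ?_ (fun j => ?_) i <;> simp
  simp only [tupleD]
  rw [Fin.sum_univ_succ, h0, sub_eq_add_neg, ← Finset.sum_neg_distrib]
  simp [h1, pow_succ]

theorem tupleD_sub {m : ℕ} (c c' : (Fin m → X) → A) (s : Fin (m + 1) → X) :
    tupleD (fun t => c t - c' t) s = tupleD c s - tupleD c' s := by
  simp [tupleD, smul_sub]

theorem tupleD_tupleD {m : ℕ} (c : (Fin m → X) → A) (s : Fin (m + 2) → X) :
    tupleD (tupleD c) s = 0 := by
  obtain ⟨x, r, rfl⟩ : ∃ x r, s = Fin.cons x r := ⟨s 0, Fin.tail s, by simp⟩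
  rw [tupleD_cons]
  induction m generalizing x with
  | zero =>
    have h (t t' : Fin 0 → X) : c t = c t' := congrArg c (Subsingleton.elim _ _)
    simp [tupleD, h _ default]
  | succ m ih =>
    obtain ⟨y, r, rfl⟩ : ∃ y r', r = Fin.cons y r' := ⟨r 0, Fin.tail r, by simp⟩
    simp only [tupleD_cons c, tupleD_sub]
    have key := ih (fun t => c (Fin.cons x t)) y r
    rw [← tupleD_cons] at key
    rw [key, sub_zero, sub_self]

/-- The homotopy between the pullbacks of functions of tuples along two maps `f` and `g`. -/
def prism (f g : X' → X) : ∀ m : ℕ, ((Fin (m + 1) → X) → A) → (Fin m → X') → A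
  | 0, _, _ => 0
  | m + 1, c, s => c (Fin.cons (f (s 0)) (g ∘ s)) -
      prism f g m (fun t => c (Fin.cons (f (s 0)) t)) (Fin.tail s)

theorem prism_sub (f g : X' → X) (m : ℕ) (c c' : (Fin (m + 1) → X) → A) (s : Fin m → X') :
    prism f g m (fun t => c t - c' t) s = prism f g m c s - prism f g m c' s := by
  induction m with
  | zero => simp [prism]
  | succ m ih => simp only [prism]; rw [ih]; abel

theorem prism_zero (f g : X' → X) (m : ℕ) (s : Fin m → X') :
    prism f g m (fun _ => (0 : A)) s = 0 := by
  induction m with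
  | zero => rfl
  | succ m ih => simp [prism, ih]

/-- Needed because the terms of a Čech differential come from different groups of sections: `φ` will
be a restriction map, and `p`, `p'` the corresponding changes of index sets. -/
theorem prism_natural (φ : A →+ A') (p : X → Y) (p' : X' → Y') (f g : X' → X) (f' g' : Y' → Y)
    (hf : ∀ x, p (f x) = f' (p' x)) (hg : ∀ x, p (g x) = g' (p' x)) (m : ℕ)
    (c : (Fin (m + 1) → X) → A) (c' : (Fin (m + 1) → Y) → A') (hc : ∀ t, φ (c t) = c' (p ∘ t))
    (s : Fin m → X') : φ (prism f g m c s) = prism f' g' m c' (p' ∘ s) := by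
  induction m with
  | zero => simp [prism]
  | succ m ih =>
    have hcons (n : ℕ) (x : X) (t : Fin n → X) :
        p ∘ (Fin.cons x t : Fin (n + 1) → X) = Fin.cons (p x) (p ∘ t) := by
      funext i; refine Fin.cases ?_ (fun j => ?_) i <;> simp
    have hgs : p ∘ g ∘ s = g' ∘ p' ∘ s := by funext i; simp [hg]
    simp only [prism, map_sub, hc, hcons, hf, hgs]
    congr 1
    rw [ih _ (fun t => c' (Fin.cons (f' (p' (s 0))) t))]
    · rfl
    · intro t; rw [hc, hcons, hf]

/-- Unrolled, `prism` is the alternating sum of `c (f s₀, …, f sⱼ, g sⱼ, g sⱼ₊₁, …)`. The induction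
freezes the first entry at `f s` and applies the hypothesis to the remaining entries; the other
terms cancel by `tupleD_cons`. -/
theorem prism_homotopy (f g : X' → X) (m : ℕ) (c : (Fin (m + 1) → X) → A)
    (r : Fin (m + 1) → X') :
    prism f g (m + 1) (tupleD c) r + tupleD (prism f g m c) r = c (g ∘ r) - c (f ∘ r) := by
  induction m with
  | zero =>
    have h : (Fin.cons (f (r 0)) (g ∘ r) : Fin 2 → X) ∘ Fin.succAbove 1 = f ∘ r := by
      funext i; rw [Subsingleton.elim i 0]; simp
    simp [prism, tupleD, Fin.sum_univ_two, h, sub_eq_add_neg]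
  | succ m ih =>
    obtain ⟨s, r, rfl⟩ : ∃ s r', r = Fin.cons s r' := ⟨r 0, Fin.tail r, by simp⟩
    have hg : g ∘ (Fin.cons s r : Fin (m + 2) → X') = Fin.cons (g s) (g ∘ r) := by
      funext i; refine Fin.cases ?_ (fun j => ?_) i <;> simp
    have hf : f ∘ (Fin.cons s r : Fin (m + 2) → X') = Fin.cons (f s) (f ∘ r) := by
      funext i; refine Fin.cases ?_ (fun j => ?_) i <;> simp
    have hg' (t : Fin m → X') :
        g ∘ (Fin.cons s t : Fin (m + 1) → X') = Fin.cons (g s) (g ∘ t) := by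
      funext i; refine Fin.cases ?_ (fun j => ?_) i <;> simp
    have key := ih (fun t => c (Fin.cons (f s) t)) r
    have e1 : prism f g (m + 2) (tupleD c) (Fin.cons s r) =
        tupleD c (Fin.cons (f s) (Fin.cons (g s) (g ∘ r))) -
          prism f g (m + 1) (fun t => tupleD c (Fin.cons (f s) t)) r := by
      rw [prism, hg]; rfl
    have e2 : tupleD (prism f g (m + 1) c) (Fin.cons s r) = prism f g (m + 1) c r -
        (tupleD (fun t => c (Fin.cons (f s) (Fin.cons (g s) (g ∘ t)))) r -
          tupleD (prism f g m (fun t => c (Fin.cons (f s) t))) r) := by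
      rw [tupleD_cons, ← tupleD_sub]
      congr 2
      funext t
      rw [prism, hg']; rfl
    have e3 : tupleD (fun t => c (Fin.cons (f s) (Fin.cons (g s) (g ∘ t)))) r =
        tupleD (fun t => c (Fin.cons (f s) (Fin.cons (g s) t))) (g ∘ r) := rfl
    simp only [tupleD_cons, prism_sub] at e1
    rw [e1, e2, e3, hg, hf, ← sub_eq_zero]
    rw [← sub_eq_zero] at key
    rw [← key]
    abel

end Prism

/-! ### Refinements along maps of the index set -/

section Refinement

variable {N : Type u} [TopologicalSpace N]

theorem AbSheaf.res_self (L : AbSheaf N) {U : Opens N} (s : L.sec U) : L.res le_rfl s = s :=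
  congrArg (fun f => f.hom s) (L.presheaf.map_id (op U))

theorem PtCover.inter_comp_le {W U : PtCover N} {τ : N → N} (h : ∀ x, W.1 x ≤ U.1 (τ x)) {k : ℕ}
    (s : Fin (k + 1) → N) : W.inter s ≤ U.inter (τ ∘ s) := iInf_mono fun a => h (s a)

/-- The pullback of cochains along a refinement `W x ≤ U (τ x)`. -/
def Cochain.pull {W U : PtCover N} (τ : N → N) (h : ∀ x, W.1 x ≤ U.1 (τ x)) (L : AbSheaf N)
    (k : ℕ) : Cochain U L k →+ Cochain W L k where
  toFun c := fun s => L.res (PtCover.inter_comp_le h s) (c (τ ∘ s))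
  map_zero' := by funext s; simp
  map_add' c c' := by funext s; simp

variable {W U : PtCover N} {L : AbSheaf N}

theorem Cochain.d_apply (k : ℕ) (c : Cochain U L k) (s : Fin (k + 2) → N) :
    Cochain.d U L k c s = ∑ a : Fin (k + 2), (-1 : ℤ) ^ (a : ℕ) •
      L.res (U.inter_face s a) (c (s ∘ a.succAbove)) := rfl

theorem Cochain.pull_apply (τ : N → N) (h : ∀ x, W.1 x ≤ U.1 (τ x)) (k : ℕ) (c : Cochain U L k)
    (s : Fin (k + 1) → N) :
    Cochain.pull τ h L k c s = L.res (PtCover.inter_comp_le h s) (c (τ ∘ s)) := rfl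

theorem Cochain.d_pull (τ : N → N) (h : ∀ x, W.1 x ≤ U.1 (τ x)) (k : ℕ) (c : Cochain U L k) :
    Cochain.d W L k (Cochain.pull τ h L k c) =
      Cochain.pull τ h L (k + 1) (Cochain.d U L k c) := by
  funext s
  simp only [Cochain.d_apply, Cochain.pull_apply, map_sum, map_zsmul, AbSheaf.res_res]
  rfl

theorem PtCover.le_inter (U : PtCover N) {O : Opens N} {k : ℕ}
    (t : Fin (k + 1) → {x // O ≤ U.1 x}) :
    O ≤ U.inter fun a => (t a).1 := le_iInf fun a => (t a).2

/-- The restriction of a cochain to an open set, as a function of tuples of those members of the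
cover that contain the open set. -/
def Cochain.restrict {k : ℕ} (c : Cochain U L k) (O : Opens N)
    (t : Fin (k + 1) → {x // O ≤ U.1 x}) : L.sec O :=
  L.res (U.le_inter t) (c fun a => (t a).1)

/-- After restriction to one open set all terms lie in the single group `L(O)`, so identities for
`tupleD` apply to the Čech differential. -/
theorem Cochain.restrict_d {k : ℕ} (c : Cochain U L k) (O : Opens N) :
    (Cochain.d U L k c).restrict O = tupleD (c.restrict O) := by
  funext t
  simp only [Cochain.restrict, Cochain.d_apply, map_sum, map_zsmul, AbSheaf.res_res, tupleD]
  rfl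

/-- The action of a refinement on the members of the covers that contain a given open set. -/
def refineIndex {τ : N → N} (h : ∀ x, W.1 x ≤ U.1 (τ x)) (O : Opens N) (x : {x // O ≤ W.1 x}) :
    {x // O ≤ U.1 x} := ⟨τ x.1, x.2.trans (h x.1)⟩

/-- The members of a tuple all contain the intersection. -/
def interIndex (W : PtCover N) {k : ℕ} (s : Fin (k + 1) → N) (a : Fin (k + 1)) :
    {x // W.inter s ≤ W.1 x} := ⟨s a, W.inter_le s a⟩

theorem Cochain.restrict_inter {k : ℕ} (c : Cochain U L k) (s : Fin (k + 1) → N) :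
    c.restrict (U.inter s) (interIndex U s) = c s := L.res_self _

theorem Cochain.d_d (k : ℕ) (c : Cochain U L k) :
    Cochain.d U L (k + 1) (Cochain.d U L k c) = 0 := by
  funext s
  refine (Cochain.restrict_inter (Cochain.d U L (k + 1) (Cochain.d U L k c)) s).symm.trans ?_
  rw [Cochain.restrict_d, Cochain.restrict_d, tupleD_tupleD]
  rfl

/-- The homotopy between the pullbacks along two refinements. -/
def Cochain.homotopy {σ τ : N → N} (hσ : ∀ x, W.1 x ≤ U.1 (σ x)) (hτ : ∀ x, W.1 x ≤ U.1 (τ x))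
    {k : ℕ} (c : Cochain U L (k + 1)) : Cochain W L k := fun s =>
  prism (refineIndex hσ _) (refineIndex hτ _) (k + 1) (c.restrict (W.inter s)) (interIndex W s)

theorem Cochain.d_homotopy {σ τ : N → N} (hσ : ∀ x, W.1 x ≤ U.1 (σ x))
    (hτ : ∀ x, W.1 x ≤ U.1 (τ x)) {k : ℕ} (c : Cochain U L (k + 1))
    (hc : Cochain.d U L (k + 1) c = 0) :
    Cochain.d W L k (c.homotopy hσ hτ) =
      Cochain.pull τ hτ L (k + 1) c - Cochain.pull σ hσ L (k + 1) c := by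
  funext s
  have key := prism_homotopy (refineIndex hσ (W.inter s)) (refineIndex hτ (W.inter s)) (k + 1)
    (c.restrict (W.inter s)) (interIndex W s)
  have h0 : tupleD (c.restrict (W.inter s)) = fun _ => 0 := by
    rw [← Cochain.restrict_d, hc]
    funext t
    exact map_zero (L.res (U.le_inter t))
  rw [h0, prism_zero, zero_add] at key
  refine Eq.trans ?_ key
  rw [Cochain.d_apply]
  refine Finset.sum_congr rfl fun a _ => congrArg (fun x => (-1 : ℤ) ^ (a : ℕ) • x) ?_
  -- A member of the cover that contains the intersection of a face also contains the smaller full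
  -- intersection.
  let p (V : PtCover N) : {x // W.inter (s ∘ a.succAbove) ≤ V.1 x} → {x // W.inter s ≤ V.1 x} :=
    fun x => ⟨x.1, (W.inter_face s a).trans x.2⟩
  refine prism_natural (L.res (W.inter_face s a)) (p U) (p W) _ _ _ _ (fun _ => rfl)
    (fun _ => rfl) (k + 1) _ _ (fun t => ?_) _
  simp only [Cochain.restrict, AbSheaf.res_res]
  rfl

end Refinement

/-! ### Classes in Čech cohomology -/

section Classes

variable {N : Type u} [TopologicalSpace N] {L : AbSheaf N}

instance : IsDirectedOrder (PtCover N)ᵒᵈ where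
  directed U V := ⟨OrderDual.toDual ⟨fun x => (OrderDual.ofDual U).1 x ⊓ (OrderDual.ofDual V).1 x,
    fun x => ⟨(OrderDual.ofDual U).2 x, (OrderDual.ofDual V).2 x⟩⟩,
    fun _ => inf_le_left, fun _ => inf_le_right⟩

instance : Nonempty (PtCover N)ᵒᵈ := ⟨OrderDual.toDual ⟨fun _ => ⊤, fun _ => trivial⟩⟩

/-- The pullback of cocycles along a refinement. -/
def Cocycle.pull {W U : PtCover N} (τ : N → N) (h : ∀ x, W.1 x ≤ U.1 (τ x)) (L : AbSheaf N)
    (k : ℕ) (z : Cocycle U L k) : Cocycle W L k :=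
  ⟨Cochain.pull τ h L k z.1, by
    have hz : Cochain.d U L k z.1 = 0 := z.2
    change Cochain.d W L k _ = 0
    rw [Cochain.d_pull, hz, map_zero]⟩

instance (L : AbSheaf N) (k : ℕ) : DirectedSystem
    (fun U : (PtCover N)ᵒᵈ => CoverH (OrderDual.ofDual U) L k)
    (fun _ _ h => CoverH.map (OrderDual.ofDual_le_ofDual.mpr h) (𝟙 L) k) where
  map_self U x := by
    induction x using QuotientAddGroup.induction_on with | _ z
    apply congrArg (QuotientAddGroup.mk)
    apply Subtype.ext
    funext s
    exact L.res_self _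
  map_map U V W h h' x := by
    induction x using QuotientAddGroup.induction_on with | _ z
    apply congrArg (QuotientAddGroup.mk)
    apply Subtype.ext
    funext s
    exact L.res_res _ _ _

theorem CechH.exists_cls {k : ℕ} (c : CechH L k) : ∃ U z, CechH.cls U L k z = c := by
  classical
  induction c using AddCommGroup.DirectLimit.induction_on with | ih U x
  induction x using QuotientAddGroup.induction_on with | _ z
  exact ⟨OrderDual.ofDual U, z, rfl⟩

theorem CechH.cls_pull_id {W U : PtCover N} (h : W ≤ U) (k : ℕ) (z : Cocycle U L k) :
    CechH.cls W L k (Cocycle.pull id h L k z) = CechH.cls U L k z := by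
  classical
  exact AddCommGroup.DirectLimit.of_f
    (G := fun U : (PtCover N)ᵒᵈ => CoverH (OrderDual.ofDual U) L k)
    (f := fun _ _ h => CoverH.map (OrderDual.ofDual_le_ofDual.mpr h) (𝟙 L) k)
    (i := OrderDual.toDual U) (j := OrderDual.toDual W) h (QuotientAddGroup.mk z)

theorem CoverH.mk_eq_zero_iff {U : PtCover N} {k : ℕ} (z : Cocycle U L (k + 1)) :
    (QuotientAddGroup.mk z : CoverH U L (k + 1)) = 0 ↔
      ∃ b : Cochain U L k, z.1 = Cochain.d U L k b := by
  rw [QuotientAddGroup.eq_zero_iff]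
  exact ⟨fun ⟨b, hb⟩ => ⟨b, hb.symm⟩, fun ⟨b, hb⟩ => ⟨b, hb.symm⟩⟩

open Classical in
/-- The map from the cohomology of a cover to Čech cohomology. -/
noncomputable def CechH.ofCover (U : PtCover N) (L : AbSheaf N) (k : ℕ) :
    CoverH U L k →+ CechH L k :=
  AddCommGroup.DirectLimit.of (fun U : (PtCover N)ᵒᵈ => CoverH (OrderDual.ofDual U) L k)
    (fun _ _ h => CoverH.map (OrderDual.ofDual_le_ofDual.mpr h) (𝟙 L) k)
    (OrderDual.toDual U)

theorem CechH.cls_eq_ofCover {U : PtCover N} {k : ℕ} (z : Cocycle U L k) :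
    CechH.cls U L k z = CechH.ofCover U L k (QuotientAddGroup.mk z) := rfl

theorem CechH.exists_of_ofCover_eq_zero {U : PtCover N} {k : ℕ} (x : CoverH U L k)
    (h : CechH.ofCover U L k x = 0) :
    ∃ (W : PtCover N) (hW : W ≤ U), CoverH.map hW (𝟙 L) k x = 0 := by
  classical
  obtain ⟨W, hW, h0⟩ := AddCommGroup.DirectLimit.of.zero_exact
    (G := fun U : (PtCover N)ᵒᵈ => CoverH (OrderDual.ofDual U) L k)
    (f := fun _ _ h => CoverH.map (OrderDual.ofDual_le_ofDual.mpr h) (𝟙 L) k)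
    (OrderDual.toDual U) x h
  exact ⟨OrderDual.ofDual W, hW, h0⟩

theorem CechH.cls_eq_zero_of_eq_d {U : PtCover N} {k : ℕ} (z : Cocycle U L (k + 1))
    (b : Cochain U L k) (h : z.1 = Cochain.d U L k b) : CechH.cls U L (k + 1) z = 0 := by
  rw [CechH.cls_eq_ofCover, (CoverH.mk_eq_zero_iff z).2 ⟨b, h⟩, map_zero]

theorem CechH.cls_eq_of_eq_add_d {U : PtCover N} {k : ℕ} (z z' : Cocycle U L (k + 1))
    (b : Cochain U L k) (h : z.1 = z'.1 + Cochain.d U L k b) :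
    CechH.cls U L (k + 1) z = CechH.cls U L (k + 1) z' := by
  obtain ⟨w, hw⟩ : ∃ w : Cocycle U L (k + 1), w.1 = Cochain.d U L k b :=
    ⟨⟨_, Cochain.d_d k b⟩, rfl⟩
  have e : z = z' + w := Subtype.ext (h.trans (congrArg (z'.1 + ·) hw.symm))
  rw [e, map_add, CechH.cls_eq_zero_of_eq_d w b hw, add_zero]

theorem CechH.exists_eq_d_of_cls_eq_zero {U : PtCover N} {k : ℕ} (z : Cocycle U L (k + 1))
    (h : CechH.cls U L (k + 1) z = 0) : ∃ (W : PtCover N) (hW : W ≤ U) (b : Cochain W L k),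
      Cochain.pull id hW L (k + 1) z.1 = Cochain.d W L k b := by
  obtain ⟨W, hW, h0⟩ := CechH.exists_of_ofCover_eq_zero _ h
  obtain ⟨b, hb⟩ := (CoverH.mk_eq_zero_iff (Cocycle.map hW (𝟙 L) (k + 1) z)).1 h0
  exact ⟨W, hW, b, hb⟩

/-- Since `W ≤ U` as well, the pullbacks along `τ` and along the identity can be compared: they
differ by the boundary of the prism homotopy. The homotopy lowers the degree by one, hence the
degree `k + 1`. -/
theorem CechH.cls_pull {W U : PtCover N} (hWU : W ≤ U) (τ : N → N) (h : ∀ x, W.1 x ≤ U.1 (τ x))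
    (k : ℕ) (z : Cocycle U L (k + 1)) :
    CechH.cls W L (k + 1) (Cocycle.pull τ h L (k + 1) z) = CechH.cls U L (k + 1) z := by
  rw [← CechH.cls_pull_id hWU]
  refine CechH.cls_eq_of_eq_add_d _ _ (Cochain.homotopy (σ := id) hWU h z.1) ?_
  rw [Cochain.d_homotopy _ _ _ z.2]
  exact (add_sub_cancel _ _).symm

end Classes

/-! ### The connecting homomorphism -/

section Connecting

variable {N : Type u} [TopologicalSpace N]

/-- The map on cochains of a cover induced by a morphism of sheaves. -/
def Cochain.app {L M : AbSheaf N} (φ : L ⟶ M) {U : PtCover N} {k : ℕ} :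
    Cochain U L k →+ Cochain U M k where
  toFun c := fun s => AbSheaf.app φ _ (c s)
  map_zero' := by funext s; simp
  map_add' c c' := by funext s; simp

theorem Cochain.d_app {L M : AbSheaf N} (φ : L ⟶ M) {U : PtCover N} {k : ℕ} (c : Cochain U L k) :
    Cochain.d U M k (Cochain.app φ c) = Cochain.app φ (Cochain.d U L k c) := by
  funext s
  simp only [Cochain.d_apply, Cochain.app, AddMonoidHom.coe_mk, ZeroHom.coe_mk, map_sum,
    map_zsmul, AbSheaf.res_app]

theorem Cochain.pull_app {L M : AbSheaf N} (φ : L ⟶ M) {W U : PtCover N} (τ : N → N)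
    (h : ∀ x, W.1 x ≤ U.1 (τ x)) {k : ℕ} (c : Cochain U L k) :
    Cochain.pull τ h M k (Cochain.app φ c) = Cochain.app φ (Cochain.pull τ h L k c) := by
  funext s
  exact AbSheaf.res_app φ _ _

/-- Every section of `C` lifts locally along `g`. -/
def LocallyLifts {B C : AbSheaf N} (g : B ⟶ C) : Prop :=
  ∀ (U : Opens N) (c : C.sec U), ∀ x ∈ U, ∃ (V : Opens N) (h : V ≤ U) (b : B.sec V),
    x ∈ V ∧ AbSheaf.app g V b = C.res h c

/-- Every cochain lifts along `g` after a refinement. -/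
def CochainsLift {B C : AbSheaf N} (g : B ⟶ C) : Prop :=
  ∀ (U : PtCover N) (k : ℕ) (e : Cochain U C k), ∃ (W : PtCover N) (_ : W ≤ U) (τ : N → N)
    (h : ∀ x, W.1 x ≤ U.1 (τ x)) (b : Cochain W B k), Cochain.app g b = Cochain.pull τ h C k e

/-- The Čech cohomology of every cover vanishes in positive degrees. -/
def CechAcyclic (B : AbSheaf N) : Prop :=
  ∀ (U : PtCover N) (k : ℕ) (z : Cochain U B (k + 1)), Cochain.d U B (k + 1) z = 0 →
    ∃ b : Cochain U B k, z = Cochain.d U B k b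

/-- Exactness of `0 → A → B → C` on sections. -/
structure IsLeftExact {A B C : AbSheaf N} (f : A ⟶ B) (g : B ⟶ C) : Prop where
  injective : ∀ U, Function.Injective (AbSheaf.app f U)
  comp : ∀ U a, AbSheaf.app g U (AbSheaf.app f U a) = 0
  exact : ∀ U b, AbSheaf.app g U b = 0 → ∃ a, AbSheaf.app f U a = b

variable {A B C : AbSheaf N} {f : A ⟶ B} {g : B ⟶ C}

theorem IsLeftExact.cochain_injective (h : IsLeftExact f g) {U : PtCover N} {k : ℕ} :
    Function.Injective (Cochain.app f : Cochain U A k →+ Cochain U B k) := fun _ _ e =>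
  funext fun s => h.injective _ (congrFun e s)

theorem IsLeftExact.cochain_comp (h : IsLeftExact f g) {U : PtCover N} {k : ℕ}
    (a : Cochain U A k) : Cochain.app g (Cochain.app f a) = 0 := funext fun _ => h.comp _ _

theorem IsLeftExact.cochain_exact (h : IsLeftExact f g) {U : PtCover N} {k : ℕ}
    (b : Cochain U B k) (hb : Cochain.app g b = 0) : ∃ a, Cochain.app f a = b := by
  choose a ha using fun s => h.exact _ (b s) (congrFun hb s)
  exact ⟨a, funext ha⟩

theorem isConnecting_iff {k : ℕ} {c : CechH C k} {d : CechH A (k + 1)} :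
    IsConnecting f g c d ↔
      ∃ (U : PtCover N) (z : Cocycle U C k) (b : Cochain U B k) (w : Cocycle U A (k + 1)),
        CechH.cls U C k z = c ∧ CechH.cls U A (k + 1) w = d ∧
        Cochain.app g b = z.1 ∧ Cochain.app f w.1 = Cochain.d U B k b := by
  constructor
  · rintro ⟨U, z, b, w, h1, h2, h3, h4⟩
    exact ⟨U, z, b, w, h1, h2, funext h3, funext h4⟩
  · rintro ⟨U, z, b, w, h1, h2, h3, h4⟩
    exact ⟨U, z, b, w, h1, h2, congrFun h3, congrFun h4⟩

theorem IsConnecting.add {k : ℕ} {c c' : CechH C k} {d d' : CechH A (k + 1)}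
    (h : IsConnecting f g c d) (h' : IsConnecting f g c' d') :
    IsConnecting f g (c + c') (d + d') := by
  obtain ⟨U, z, b, w, rfl, rfl, h3, h4⟩ := isConnecting_iff.1 h
  obtain ⟨U', z', b', w', rfl, rfl, h3', h4'⟩ := isConnecting_iff.1 h'
  let W : PtCover N := ⟨fun x => U.1 x ⊓ U'.1 x, fun x => ⟨U.2 x, U'.2 x⟩⟩
  have hW : W ≤ U := fun _ => inf_le_left
  have hW' : W ≤ U' := fun _ => inf_le_right
  refine isConnecting_iff.2 ⟨W, Cocycle.pull id hW C k z + Cocycle.pull id hW' C k z',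
    Cochain.pull id hW B k b + Cochain.pull id hW' B k b',
    Cocycle.pull id hW A (k + 1) w + Cocycle.pull id hW' A (k + 1) w', ?_, ?_, ?_, ?_⟩
  · rw [map_add, CechH.cls_pull_id, CechH.cls_pull_id]
  · rw [map_add, CechH.cls_pull_id, CechH.cls_pull_id]
  · rw [map_add, ← Cochain.pull_app, ← Cochain.pull_app, h3, h3']; rfl
  · rw [map_add, Cochain.d_pull, Cochain.d_pull, ← h4, ← h4', Cochain.pull_app, Cochain.pull_app,
      ← map_add]; rfl

/-- If `z = ∂e`, lift `e` to a `B`-cochain `e'` on a finer cover. Then `b - ∂e'` is killed by `g`,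
so it is `f v`, and injectivity of `f` gives `w = ∂v`. -/
theorem IsConnecting.eq_zero_of_left (hfg : IsLeftExact f g) (hg : CochainsLift g) {k : ℕ}
    {d : CechH A (k + 2)} (h : IsConnecting f g (0 : CechH C (k + 1)) d) : d = 0 := by
  obtain ⟨U, z, b, w, hz, rfl, h3, h4⟩ := isConnecting_iff.1 h
  obtain ⟨W, hW, e, he⟩ := CechH.exists_eq_d_of_cls_eq_zero z hz
  obtain ⟨V, hV, τ, hτ, e', he'⟩ := hg W k e
  have hVU : ∀ x, V.1 x ≤ U.1 (τ x) := fun x => (hτ x).trans (hW _)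
  have hpull : Cochain.pull τ hVU C (k + 1) z.1 =
      Cochain.pull τ hτ C (k + 1) (Cochain.pull id hW C (k + 1) z.1) := by
    funext s
    exact (C.res_res _ _ _).symm
  obtain ⟨v, hv⟩ := hfg.cochain_exact
    (Cochain.pull τ hVU B (k + 1) b - Cochain.d V B k e') (by
      rw [map_sub, ← Cochain.pull_app, h3, hpull, he, ← Cochain.d_pull, ← Cochain.d_app, he',
        sub_self])
  rw [← CechH.cls_pull (hV.trans hW) τ hVU]
  refine CechH.cls_eq_zero_of_eq_d _ v (hfg.cochain_injective ?_)
  rw [← Cochain.d_app, hv, map_sub, Cochain.d_d, sub_zero, Cochain.d_pull, ← h4, Cochain.pull_app]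
  rfl

/-- If `w = ∂v`, then `b - f v` is a `B`-cocycle, hence `∂β` by acyclicity, and applying `g` gives
`z = ∂(g β)`. -/
theorem IsConnecting.eq_zero_of_right (hfg : IsLeftExact f g) (hB : CechAcyclic B) {k : ℕ}
    {c : CechH C (k + 1)} (h : IsConnecting f g c (0 : CechH A (k + 2))) : c = 0 := by
  obtain ⟨U, z, b, w, rfl, hw, h3, h4⟩ := isConnecting_iff.1 h
  obtain ⟨W, hW, v, hv⟩ := CechH.exists_eq_d_of_cls_eq_zero w hw
  obtain ⟨β, hβ⟩ := hB W k (Cochain.pull id hW B (k + 1) b - Cochain.app f v) (by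
    rw [map_sub, Cochain.d_pull, ← h4, Cochain.pull_app, hv, Cochain.d_app, sub_self])
  rw [← CechH.cls_pull_id hW]
  refine CechH.cls_eq_zero_of_eq_d _ (Cochain.app g β) ?_
  rw [Cochain.d_app, ← hβ, map_sub, hfg.cochain_comp, sub_zero, ← Cochain.pull_app, h3]
  rfl

/-- The lift exists only after refining along some `τ`; `CechH.cls_pull` ensures that the class of
`z` is unchanged. -/
theorem exists_isConnecting_right (hfg : IsLeftExact f g) (hg : CochainsLift g) {k : ℕ}
    (c : CechH C (k + 1)) : ∃ d, IsConnecting f g c d := by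
  obtain ⟨U, z, rfl⟩ := CechH.exists_cls c
  obtain ⟨W, hW, τ, hτ, b, hb⟩ := hg U _ z.1
  obtain ⟨w, hw⟩ := hfg.cochain_exact (Cochain.d W B (k + 1) b) (by
    rw [← Cochain.d_app, hb]
    exact (Cocycle.pull τ hτ C (k + 1) z).2)
  have hdw : Cochain.d W A (k + 2) w = 0 := hfg.cochain_injective (by
    rw [← Cochain.d_app, hw, Cochain.d_d, map_zero])
  exact ⟨_, isConnecting_iff.2 ⟨W, Cocycle.pull τ hτ C (k + 1) z, b, ⟨w, hdw⟩,
    CechH.cls_pull hW τ hτ k z, rfl, hb, hw⟩⟩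

theorem exists_isConnecting_left (hfg : IsLeftExact f g) (hB : CechAcyclic B) {k : ℕ}
    (d : CechH A (k + 2)) : ∃ c : CechH C (k + 1), IsConnecting f g c d := by
  obtain ⟨U, w, rfl⟩ := CechH.exists_cls d
  have hdw : Cochain.d U A (k + 2) w.1 = 0 := w.2
  obtain ⟨b, hb⟩ := hB U (k + 1) (Cochain.app f w.1) (by rw [Cochain.d_app, hdw, map_zero])
  have hz : Cochain.d U C (k + 1) (Cochain.app g b) = 0 := by
    rw [Cochain.d_app, ← hb, hfg.cochain_comp]
  exact ⟨_, isConnecting_iff.2 ⟨U, ⟨_, hz⟩, b, w, rfl, rfl, rfl, hb⟩⟩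

/-- Additivity reduces this to the class zero: any `e` connected to `-c` makes `d + e` connected to
`0`. -/
theorem IsConnecting.right_unique (hfg : IsLeftExact f g) (hg : CochainsLift g) {k : ℕ}
    {c : CechH C (k + 1)} {d d' : CechH A (k + 2)} (h : IsConnecting f g c d)
    (h' : IsConnecting f g c d') : d = d' := by
  obtain ⟨e, he⟩ := exists_isConnecting_right hfg hg (-c)
  have key {d : CechH A (k + 2)} (h : IsConnecting f g c d) : d = -e :=
    eq_neg_of_add_eq_zero_left (IsConnecting.eq_zero_of_left hfg hg (by simpa using h.add he))
  rw [key h, key h']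

theorem IsConnecting.left_unique (hfg : IsLeftExact f g) (hB : CechAcyclic B) {k : ℕ}
    {c c' : CechH C (k + 1)} {d : CechH A (k + 2)} (h : IsConnecting f g c d)
    (h' : IsConnecting f g c' d) : c = c' := by
  obtain ⟨e, he⟩ := exists_isConnecting_left (C := C) (g := g) hfg hB (-d)
  have key {c : CechH C (k + 1)} (h : IsConnecting f g c d) : c = -e :=
    eq_neg_of_add_eq_zero_left (IsConnecting.eq_zero_of_right hfg hB (by simpa using h.add he))
  rw [key h, key h']

/-- If `B` is acyclic, then the connecting homomorphism of `0 → A → B → C → 0` is an isomorphism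
in positive degrees. -/
theorem exists_connecting_addEquiv (hfg : IsLeftExact f g) (hg : CochainsLift g)
    (hB : CechAcyclic B) (k : ℕ) :
    ∃ δ : CechH C (k + 1) ≃+ CechH A (k + 2), ∀ c d, IsConnecting f g c d ↔ δ c = d := by
  choose δ hδ using exists_isConnecting_right (k := k) hfg hg
  choose ε hε using exists_isConnecting_left (C := C) (g := g) (k := k) hfg hB
  refine ⟨{ toFun := δ
            invFun := ε
            left_inv := fun c => (hε _).left_unique hfg hB (hδ c)
            right_inv := fun d => (hδ _).right_unique hfg hg (hε d)
            map_add' := fun c c' => (hδ _).right_unique hfg hg ((hδ c).add (hδ c')) },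
    fun c d => ⟨fun h => (hδ c).right_unique hfg hg h, fun h => ?_⟩⟩
  exact h ▸ hδ c

end Connecting

/-! ### Lifting cochains on paracompact spaces -/

section Lifting

variable {N : Type u} [TopologicalSpace N]

/-- Handles the tuples of indices whose intersection is empty, where no point is available for a
local argument. -/
theorem AbSheaf.eq_zero_of_isEmpty (L : AbSheaf N) {O : Opens N} (hO : ∀ x, x ∉ O) (s : L.sec O) :
    s = 0 := by
  obtain rfl : O = ⊥ := by ext x; simpa using hO x
  have := L.isTerminalOfEmpty.hom_ext (𝟙 _) 0
  exact congrArg (fun φ => φ.hom s) this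

/-- On a paracompact Hausdorff space, cochains lift after a refinement as soon as sections lift
locally. -/
theorem LocallyLifts.cochainsLift [T2Space N] [ParacompactSpace N] {B C : AbSheaf N} {g : B ⟶ C}
    (hg : LocallyLifts g) : CochainsLift g := by
  intro U k e
  -- Take a locally finite refinement `V` of `U`, then shrink it to `V'` with closures inside `V`;
  -- `τ x` picks a member of `V'` containing `x`.
  obtain ⟨V, hVo, hVc, hVf, hVU⟩ := precise_refinement (fun x => (U.1 x : Set N))
    (fun x => (U.1 x).2) (Set.eq_univ_of_forall fun x => Set.mem_iUnion.2 ⟨x, U.2 x⟩)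
  obtain ⟨V', hVc', hVo', hVV'⟩ := exists_iUnion_eq_closure_subset hVo
    (fun x => hVf.point_finite x) hVc
  choose τ hτ using fun x => Set.mem_iUnion.1 (hVc'.symm ▸ Set.mem_univ x : x ∈ ⋃ i, V' i)
  have hmem {t : Fin (k + 1) → N} {x : N} (ht : ∀ a, x ∈ V (t a)) : x ∈ U.inter t := by
    have : x ∈ ⋂ a, (U.1 (t a) : Set N) := Set.mem_iInter.2 fun a => hVU _ (ht a)
    rw [PtCover.inter, ← SetLike.mem_coe, Opens.coe_iInf]
    exact this
  -- The neighbourhood `W` of `x` lies in `V' (τ x)`, meets `V' i` only when `x ∈ V i`, and is so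
  -- small that `e t` lifts on it for every tuple `t` of members of `V` around `x`.
  have hW (x : N) : ∃ W : Opens N, x ∈ W ∧ W ≤ U.1 x ∧ (W : Set N) ⊆ V' (τ x) ∧
      (∀ i, ((W : Set N) ∩ V' i).Nonempty → x ∈ V i) ∧
      ∀ t : Fin (k + 1) → N, (∀ a, x ∈ V (t a)) → ∀ (O : Opens N) (h : O ≤ U.inter t), O ≤ W →
        ∃ b : B.sec O, AbSheaf.app g O b = C.res h (e t) := by
    -- By local finiteness the union of the closures avoiding `x` is closed, so its complement is a
    -- neighbourhood of `x`.
    have h3 : (⋃ i : {i // x ∉ V i}, closure (V' i))ᶜ ∈ nhds x := by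
      have hf : LocallyFinite fun i : {i // x ∉ V i} => closure (V' i) :=
        (hVf.subset hVV').comp_injective Subtype.val_injective
      refine (hf.isClosed_iUnion fun _ => isClosed_closure).isOpen_compl.mem_nhds ?_
      simp only [Set.mem_compl_iff, Set.mem_iUnion, not_exists]
      exact fun i hi => i.2 (hVV' _ hi)
    -- Only finitely many tuples matter at `x`, so their lifting neighbourhoods can be intersected.
    have hfin : {t : Fin (k + 1) → N | ∀ a, x ∈ V (t a)}.Finite := by
      have := Set.Finite.pi (t := fun _ : Fin (k + 1) => {i | x ∈ V i})
        fun _ => hVf.point_finite x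
      refine this.subset fun t ht a _ => ht a
    have h4 : ∀ t ∈ {t : Fin (k + 1) → N | ∀ a, x ∈ V (t a)}, ∃ S ∈ nhds x, ∀ (O : Opens N)
        (h : O ≤ U.inter t), (O : Set N) ⊆ S →
        ∃ b : B.sec O, AbSheaf.app g O b = C.res h (e t) := by
      intro t ht
      obtain ⟨S, hS, b, hxS, hb⟩ := hg (U.inter t) (e t) x (hmem ht)
      refine ⟨S, S.2.mem_nhds hxS, fun O h hO => ?_⟩
      have hOS : O ≤ S := hO
      refine ⟨B.res hOS b, ?_⟩
      rw [← AbSheaf.res_app, hb, AbSheaf.res_res]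
    choose! S hS hSl using h4
    obtain ⟨W, hWsub, hWo, hxW⟩ := mem_nhds_iff.1 (Filter.inter_mem
      (Filter.inter_mem ((U.1 x).2.mem_nhds (U.2 x)) ((hVo' (τ x)).mem_nhds (hτ x)))
      (Filter.inter_mem h3 ((Filter.biInter_mem hfin).2 hS)))
    refine ⟨⟨W, hWo⟩, hxW, fun y hy => (hWsub hy).1.1, fun y hy => (hWsub hy).1.2, ?_, ?_⟩
    · rintro i ⟨y, hyW, hyi⟩
      by_contra hx
      exact (hWsub hyW).2.1 (Set.mem_iUnion.2 ⟨⟨i, hx⟩, subset_closure hyi⟩)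
    · intro t ht O h hO
      exact hSl t ht O h fun y hy => Set.mem_iInter₂.1 (hWsub (hO hy)).2.2 t ht
  choose W hxW hWU hWV hWi hWl using hW
  have hWτ (x : N) : W x ≤ U.1 (τ x) := fun y hy =>
    hVU _ (hVV' _ (subset_closure (hWV x hy)))
  let W' : PtCover N := ⟨W, hxW⟩
  -- A point `y` of the intersection shows that `W (s 0)` meets each `V' (τ (s a))`. Hence `s 0`
  -- lies in every `V (τ (s a))`, and the lift of `e (τ ∘ s)` available near `s 0` can be used.
  have hb (s : Fin (k + 1) → N) : ∃ b : B.sec (W'.inter s),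
      AbSheaf.app g _ b = Cochain.pull (W := W') τ hWτ C k e s := by
    by_cases hs : ∃ y, y ∈ W'.inter s
    · obtain ⟨y, hy⟩ := hs
      exact hWl (s 0) (τ ∘ s) (fun a => hWi _ _ ⟨y, W'.inter_le s 0 hy,
        hWV _ (W'.inter_le s a hy)⟩) _ _ (W'.inter_le s 0)
    · exact ⟨0, by rw [map_zero]; exact (C.eq_zero_of_isEmpty (not_exists.1 hs) _).symm⟩
  choose b hb using hb
  exact ⟨W', hWU, τ, hWτ, b, funext hb⟩

end Lifting

/-! ### The exponential sequence on a smooth manifold -/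

section Smooth

variable {E : Type*} [NormedAddCommGroup E] [NormedSpace ℝ E] {H : Type*} [TopologicalSpace H]
  {I : ModelWithCorners ℝ E H} {N : Type u} [TopologicalSpace N] [ChartedSpace H N]

theorem intSheaf_ext {O : Opens N} {s t : (intSheaf N).sec O}
    (h : ∀ x, s.1 x = t.1 x) : s = t := Subtype.ext (funext h)

theorem smoothSheafC_ext {O : Opens N} {s t : (smoothSheafC I N).sec O}
    (h : ∀ x, s.1 x = t.1 x) : s = t := Subtype.ext (funext h)

theorem smoothSheafCStar_ext {O : Opens N} {s t : (smoothSheafCStar I N).sec O}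
    (h : ∀ x, ((s.1 x).toMul : ℂ) = ((t.1 x).toMul : ℂ)) : s = t :=
  Subtype.ext (funext fun x => Additive.toMul.injective (Units.ext (h x)))

theorem intToSmooth_apply {O : Opens N} (s : (intSheaf N).sec O) (x : O) :
    (AbSheaf.app (intToSmooth I N) O s).1 x = ((s.1 x : ℤ) : ℂ) := rfl

theorem smoothExp_apply {O : Opens N} (s : (smoothSheafC I N).sec O) (x : O) :
    (((AbSheaf.app (smoothExp I N) O s).1 x).toMul : ℂ) =
      Complex.exp (2 * Real.pi * Complex.I * s.1 x) := rfl

theorem smoothSheafCStar_zero_apply {O : Opens N} (x : O) :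
    (((0 : (smoothSheafCStar I N).sec O).1 x).toMul : ℂ) = 1 := rfl

theorem exp_two_pi_I_mul_eq_one_iff (w : ℂ) :
    Complex.exp (2 * Real.pi * Complex.I * w) = 1 ↔ ∃ n : ℤ, w = n := by
  rw [Complex.exp_eq_one_iff]
  refine exists_congr fun n => ?_
  rw [mul_comm, mul_left_inj' Complex.two_pi_I_ne_zero]

variable (I N) in
theorem exponential_isLeftExact : IsLeftExact (intToSmooth I N) (smoothExp I N) where
  injective O s t h := by
    refine intSheaf_ext fun x => Int.cast_injective (α := ℂ) ?_
    rw [← intToSmooth_apply (I := I), ← intToSmooth_apply (I := I), h]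
  comp O s := by
    refine smoothSheafCStar_ext fun x => ?_
    rw [smoothExp_apply, smoothSheafCStar_zero_apply, exp_two_pi_I_mul_eq_one_iff]
    exact ⟨_, intToSmooth_apply _ _⟩
  exact O b hb := by
    have h (x : O) : ∃ n : ℤ, b.1 x = n := by
      rw [← exp_two_pi_I_mul_eq_one_iff, ← smoothExp_apply, hb, smoothSheafCStar_zero_apply]
    choose n hn using h
    have hb : ContMDiff I 𝓘(ℝ, ℂ) ∞ b.1 := b.2
    -- Continuity into `ℤ` can be tested in `ℝ`, where `n` becomes the real part of `b`.
    have hc : Continuous n := by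
      rw [Int.isClosedEmbedding_coe_real.isEmbedding.continuous_iff]
      have hre : Int.cast ∘ n = Complex.re ∘ b.1 := by
        funext x
        rw [Function.comp_apply, Function.comp_apply, hn, Complex.intCast_re]
      exact hre ▸ Complex.continuous_re.comp hb.continuous
    exact ⟨⟨n, hc⟩, smoothSheafC_ext fun x => (hn x).symm⟩

-- Dividing by the value `a` at `x` moves nearby values into the slit plane, where the principal
-- logarithm is smooth. Adding back `log a` gives a branch of the logarithm of the original
-- function.
variable (I N) in
theorem smoothExp_locallyLifts : LocallyLifts (smoothExp I N) := by
  intro U c x hx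
  let φ : U → ℂ := fun y => ((c.1 y).toMul : ℂ)
  have hφ : ContMDiff I 𝓘(ℝ, ℂ) ∞ φ := c.2
  have hφ0 (y : U) : φ y ≠ 0 := Units.ne_zero _
  let a : ℂ := φ ⟨x, hx⟩
  have ha : a ≠ 0 := hφ0 _
  let S : Set U := (fun y => φ y / a) ⁻¹' Complex.slitPlane
  have hS : IsOpen S := Complex.isOpen_slitPlane.preimage (hφ.continuous.div_const a)
  let V : Opens N := ⟨Subtype.val '' S, U.2.isOpenMap_subtype_val _ hS⟩
  have hV : V ≤ U := by
    rintro _ ⟨y, -, rfl⟩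
    exact y.2
  have hVS (y : V) : φ ⟨y, hV y.2⟩ / a ∈ Complex.slitPlane := by
    obtain ⟨y, z, hz, rfl⟩ := y
    exact hz
  let b : V → ℂ := fun y =>
    (Complex.log (φ ⟨y, hV y.2⟩ / a) + Complex.log a) / (2 * Real.pi * Complex.I)
  have hb : ContMDiff I 𝓘(ℝ, ℂ) ∞ b := by
    intro y
    have h1 : ContMDiffAt I 𝓘(ℝ, ℂ) ∞ (fun y : V => φ ⟨y, hV y.2⟩) y :=
      (hφ.comp (contMDiff_inclusion hV)) y
    have h2 : ContDiffAt ℝ ∞ (fun w : ℂ => (Complex.log (w / a) + Complex.log a) /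
        (2 * Real.pi * Complex.I)) (φ ⟨y, hV y.2⟩) := by
      have hlog : ContDiffAt ℝ ∞ Complex.log (φ ⟨y, hV y.2⟩ / a) :=
        (Complex.contDiffAt_log (hVS y)).restrict_scalars ℝ
      have hdiv : ContDiffAt ℝ ∞ (fun w : ℂ => w / a) (φ ⟨y, hV y.2⟩) :=
        contDiffAt_id.div_const a
      exact ((hlog.comp (φ ⟨y, hV y.2⟩) hdiv).add contDiffAt_const).div_const _
    exact h2.contMDiffAt.comp y h1
  obtain ⟨β, hβ⟩ : ∃ β : (smoothSheafC I N).sec V, ∀ y, β.1 y = b y := ⟨⟨b, hb⟩, fun _ => rfl⟩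
  refine ⟨V, hV, β, ⟨⟨x, hx⟩, ?_, rfl⟩, smoothSheafCStar_ext fun y => ?_⟩
  · change a / a ∈ Complex.slitPlane
    rw [div_self ha]
    exact Complex.one_mem_slitPlane
  · rw [smoothExp_apply, hβ]
    change Complex.exp (2 * Real.pi * Complex.I * ((Complex.log (φ ⟨y, hV y.2⟩ / a) +
      Complex.log a) / (2 * Real.pi * Complex.I))) = φ ⟨y, hV y.2⟩
    rw [mul_div_cancel₀ _ Complex.two_pi_I_ne_zero, Complex.exp_add,
      Complex.exp_log (div_ne_zero (hφ0 _) ha), Complex.exp_log ha, div_mul_cancel₀ _ ha]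

variable (I) in
/-- Evaluation of smooth functions at a point. -/
def evalAt {O : Opens N} (y : O) : (smoothSheafC I N).sec O →+ ℂ where
  toFun s := s.1 y
  map_zero' := rfl
  map_add' _ _ := rfl

theorem PtCover.mem_inter {U : PtCover N} {k : ℕ} {s : Fin (k + 1) → N} {y : N} :
    y ∈ U.inter s ↔ ∀ a, y ∈ U.1 (s a) := by
  rw [PtCover.inter, ← SetLike.mem_coe, Opens.coe_iInf]
  exact Set.mem_iInter

/-- The values at a point of a cochain of smooth functions. -/
def Cochain.valueAt {U : PtCover N} {k : ℕ} (c : Cochain U (smoothSheafC I N) k) (y : N)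
    (t : Fin (k + 1) → {x // y ∈ U.1 x}) : ℂ :=
  evalAt I ⟨y, PtCover.mem_inter.2 fun a => (t a).2⟩ (c fun a => (t a).1)

theorem Cochain.valueAt_d {U : PtCover N} {k : ℕ} (c : Cochain U (smoothSheafC I N) k) (y : N) :
    (Cochain.d U _ k c).valueAt y = tupleD (c.valueAt y) := by
  funext t
  simp only [Cochain.valueAt, Cochain.d_apply, map_sum, map_zsmul, tupleD]
  rfl

theorem Cochain.ext_valueAt {U : PtCover N} {k : ℕ} {c c' : Cochain U (smoothSheafC I N) k}
    (h : ∀ y t, c.valueAt y t = c'.valueAt y t) : c = c' :=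
  funext fun s => smoothSheafC_ext fun y => h y.1 fun a => ⟨s a, PtCover.mem_inter.1 y.2 a⟩

-- For a partition of unity `ρ` subordinate to `U`, the contraction is `b_s = ∑ᵢ ρᵢ z_{i,s}`. The
-- cocycle condition on the tuples `(i, s)` yields `∂b = ∑ᵢ ρᵢ z = z`. The identity is checked
-- pointwise, where the sum is finite.
variable (I N) in
theorem smoothSheafC_cechAcyclic [FiniteDimensional ℝ E] [IsManifold I ∞ N] [T2Space N]
    [SigmaCompactSpace N] : CechAcyclic (smoothSheafC I N) := by
  classical
  intro U k z hz
  obtain ⟨ρ, hρ⟩ := SmoothPartitionOfUnity.exists_isSubordinate I (s := Set.univ) isClosed_univ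
    (fun x => (U.1 x : Set N)) (fun x => (U.1 x).2) fun x _ => Set.mem_iUnion.2 ⟨x, U.2 x⟩
  -- The extension of `z_{i,s}` by zero need not be smooth, but its product with `ρ i` is smooth on
  -- `U.inter s`.
  let ζ (i : N) (s : Fin (k + 1) → N) (y : N) : ℂ :=
    if h : y ∈ U.inter (Fin.cons i s : Fin (k + 2) → N) then evalAt I ⟨y, h⟩ (z (Fin.cons i s))
    else 0
  have hcons {i : N} {s : Fin (k + 1) → N} {y : N} (hi : y ∈ U.1 i) (hs : y ∈ U.inter s) :
      y ∈ U.inter (Fin.cons i s : Fin (k + 2) → N) :=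
    PtCover.mem_inter.2 (Fin.cases hi fun a => PtCover.mem_inter.1 hs a)
  have hsmooth (s : Fin (k + 1) → N) : ContMDiff I 𝓘(ℝ, ℂ) ∞
      (fun y : U.inter s => ∑ᶠ i, ρ i y.1 • ζ i s y.1) := by
    intro y
    refine (contMDiffAt_subtype_iff (f := fun y => ∑ᶠ i, ρ i y • ζ i s y)).2 ?_
    -- Smoothness of `ζ i s` is required only at points of the closed support of `ρ i`, which lies
    -- in `U i`; there `ζ i s` is locally the section itself.
    refine ρ.contMDiffAt_finsum fun i hi => ?_
    have hy := hcons (hρ i hi) y.2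
    refine (contMDiffAt_subtype_iff (f := ζ i s) (x := ⟨y.1, hy⟩)).1 ?_
    have hz : ContMDiff I 𝓘(ℝ, ℂ) ∞ (z (Fin.cons i s)).1 := (z (Fin.cons i s)).2
    convert hz ⟨y.1, hy⟩ using 1
    funext x
    exact dif_pos x.2
  have hsec (s : Fin (k + 1) → N) : ∃ σ : (smoothSheafC I N).sec (U.inter s),
      ∀ y, evalAt I y σ = ∑ᶠ i, ρ i y.1 • ζ i s y.1 := ⟨⟨_, hsmooth s⟩, fun _ => rfl⟩
  choose b hb using hsec
  refine ⟨b, Cochain.ext_valueAt fun y t => ?_⟩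
  have hz' (s s' : Fin (k + 2) → N) (hs : y ∈ U.inter s) (hs' : y ∈ U.inter s') (e : s = s') :
      evalAt I ⟨y, hs⟩ (z s) = evalAt I ⟨y, hs'⟩ (z s') := by
    subst e
    rfl
  rw [Cochain.valueAt_d]
  have hval (t : Fin (k + 1) → {x // y ∈ U.1 x}) :
      Cochain.valueAt b y t = ∑ i ∈ ρ.finsupport y, ρ i y • ζ i (fun a => (t a).1) y :=
    (hb _ _).trans (ρ.sum_finsupport_smul_eq_finsum y fun i => ζ i fun a => (t a).1).symm
  -- Since `y ∈ U i`, the index `i` can be put in front of `t`; by `tupleD_cons` the vanishing of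
  -- `∂z` there is the desired equality.
  have hζ (i : N) (hi : i ∈ ρ.finsupport y) :
      tupleD (fun t : Fin (k + 1) → {x // y ∈ U.1 x} => ζ i (fun a => (t a).1) y) t =
        z.valueAt y t := by
    have hyi : y ∈ U.1 i := hρ i (subset_tsupport _ ((ρ.mem_finsupport y).1 hi))
    have h0 : tupleD (z.valueAt y) (Fin.cons ⟨i, hyi⟩ t) = 0 := by
      rw [← Cochain.valueAt_d, hz]
      rfl
    rw [tupleD_cons, sub_eq_zero] at h0
    rw [h0]
    congr 1
    funext t
    have ht : (fun a => ((Fin.cons ⟨i, hyi⟩ t : Fin (k + 2) → {x // y ∈ U.1 x}) a).1) =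
        Fin.cons i fun a => (t a).1 := by
      funext a
      refine Fin.cases ?_ (fun a => ?_) a <;> simp
    have hy := hcons hyi (PtCover.mem_inter.2 fun a => (t a).2)
    refine (dif_pos hy).trans ?_
    exact hz' _ _ _ _ ht.symm
  have hsum : ∑ i ∈ ρ.finsupport y, ρ i y = 1 := ρ.sum_finsupport y (Set.mem_univ y)
  simp only [funext hval]
  calc z.valueAt y t = ∑ i ∈ ρ.finsupport y, ρ i y • z.valueAt y t := by
        rw [← Finset.sum_smul, hsum, one_smul]
    _ = _ := by
        simp only [tupleD, Finset.smul_sum]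
        rw [Finset.sum_comm]
        refine Finset.sum_congr rfl fun i hi => ?_
        rw [← hζ i hi, tupleD, Finset.smul_sum]
        exact Finset.sum_congr rfl fun a _ => smul_comm _ _ _

end Smooth

end GerbedTowers

theorem theorem6p0p1 {E : Type*} [NormedAddCommGroup E] [NormedSpace ℝ E] [FiniteDimensional ℝ E]
    {H : Type*} [TopologicalSpace H] (I : ModelWithCorners ℝ E H)
    (N : Type u) [TopologicalSpace N] [ChartedSpace H N] [IsManifold I ∞ N]
    [T2Space N] [SigmaCompactSpace N] (n : ℕ) (hn : 1 ≤ n) :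
    ∃ δ : GerbedTowers.CechH (GerbedTowers.smoothSheafCStar I N) (n + 1) ≃+
        GerbedTowers.CechH (GerbedTowers.intSheaf N) (n + 2),
      (∀ x c, GerbedTowers.IsConnecting (GerbedTowers.intToSmooth I N)
        (GerbedTowers.smoothExp I N) x c ↔ δ x = c) ∧
      ∀ c, GerbedTowers.IsGeometric I n c →
        GerbedTowers.IsTowerClass (GerbedTowers.smoothSheafCStar I N) n (δ.symm c) := by
  -- Together with σ-compactness and the Hausdorff property this makes `N` paracompact, as
  -- `LocallyLifts.cochainsLift` requires.
  have : LocallyCompactSpace N := Manifold.locallyCompact_of_finiteDimensional I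
  obtain ⟨δ, hδ⟩ := GerbedTowers.exists_connecting_addEquiv
    (GerbedTowers.exponential_isLeftExact I N)
    (GerbedTowers.smoothExp_locallyLifts I N).cochainsLift
    (GerbedTowers.smoothSheafC_cechAcyclic I N) n
  refine ⟨δ, hδ, fun c ⟨x, hx, hxc⟩ => ?_⟩
  -- The tower class `x` witnessing that `c` is geometric satisfies `δ x = c`, so it is the preimage
  -- of `c`.
  rwa [← (hδ x c).1 hxc, δ.symm_apply_apply]
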